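/- Let $\mathcal{G}\rightrightarrows M$ be a Lie groupoid with source $s$ and target $t$ (surjective submersions $\mathcal{G}\to M$), unit inclusion $\iota: M\hookrightarrow\mathcal{G}$, and multiplication $m:\mathcal{G}^{(2)}\to\mathcal{G}$, $(g,h)\mapsto gh$, defined on $\mathcal{G}^{(2)}=\{(g,h): s(g)=t(h)\}$, with projections $\mathrm{pr}_1,\mathrm{pr}_2:\mathcal{G}^{(2)}\to\mathcal{G}$. Let $k\ge 0$. A $k$-form $\Theta\in\Omega^k(\mathcal{G})$ is called multiplicative if $m^*\Theta=\mathrm{pr}_1^*\Theta+\mathrm{pr}_2^*\Theta$, and affine if $$m^*\Theta=\mathrm{pr}_1^*\Theta+\mathrm{pr}_2^*\Theta-\mathrm{pr}_1^*s^*\theta,\qquad \theta:=\iota^*\Theta\in\Omega^k(M).$$ Let $\Omega^k_{\mathrm{aff}}(\mathcal{G})$ and $\Omega^k_{\mathrm{mult}}(\mathcal{G})$ be the real vector spaces of affine and of multiplicative $k$-forms. A $2$-vector space $V_1\rightrightarrows V_0$ is a category whose set of arrows $V_1$ and set of objects $V_0$ are vector spaces and whose source, target, identity-assigning and composition maps are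 linear. Theorem. There is a $2$-vector space $$\Omega^k_{\mathrm{aff}}(\mathcal{G})\rightrightarrows\Omega^k_{\mathrm{mult}}(\mathcal{G})$$ in which every arrow is invertible (so it is a groupoid), with source and target maps $$\Theta\mapsto\Theta_r:=\Theta-t^*\theta,\qquad \Theta\mapsto\Theta_l:=\Theta-s^*\theta\qquad(\theta=\iota^*\Theta),$$ with the inclusion $\Omega^k_{\mathrm{mult}}(\mathcal{G})\subset\Omega^k_{\mathrm{aff}}(\mathcal{G})$ as identity-assigning map, and with composition $$\Theta*\Theta'=\Theta+s^*\theta',\qquad \theta'=\iota^*\Theta',$$ for $\Theta,\Theta'\in\Omega^k_{\mathrm{aff}}(\mathcal{G})$ with $\Theta_r=\Theta'_l$. In particular, $\Theta_r$ and $\Theta_l$ are multiplicative and $\Theta*\Theta'$ is affine. -/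

import Mathlib

open scoped Manifold ContDiff Bundle

noncomputable section

/-! ### Differential forms on manifolds and their pullbacks -/

theorem norm_alternatization_le {E : Type*} [NormedAddCommGroup E] [NormedSpace ℝ E] {k : ℕ}
    (f : ContinuousMultilinearMap ℝ (fun _ : Fin k ↦ E) ℝ) :
    ‖ContinuousMultilinearMap.alternatization f‖ ≤ (k.factorial : ℝ) * ‖f‖ := by
  refine ContinuousAlternatingMap.opNorm_le_bound _ (by positivity) fun v ↦ ?_
  rw [ContinuousMultilinearMap.alternatization_apply_apply]
  refine (norm_sum_le _ _).trans ?_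
  have h : ∀ σ ∈ (Finset.univ : Finset (Equiv.Perm (Fin k))),
      ‖Equiv.Perm.sign σ • f (v ∘ σ)‖ ≤ ‖f‖ * ∏ i, ‖v i‖ := by
    intro σ _
    have h1 : ‖Equiv.Perm.sign σ • f (v ∘ σ)‖ = ‖f (v ∘ σ)‖ := by
      rcases Int.units_eq_one_or (Equiv.Perm.sign σ) with h | h <;> simp [h]
    rw [h1]
    refine (f.le_opNorm _).trans_eq ?_
    congr 1
    exact Equiv.prod_comp σ (fun i ↦ ‖v i‖)
  refine (Finset.sum_le_card_nsmul _ _ _ h).trans_eq ?_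
  simp [Fintype.card_perm, mul_assoc]

theorem contDiff_alternating_comp {E F : Type*} [NormedAddCommGroup E] [NormedSpace ℝ E]
    [NormedAddCommGroup F] [NormedSpace ℝ F] {k : ℕ} {n : WithTop ℕ∞} :
    ContDiff ℝ n (fun p : (F [⋀^Fin k]→L[ℝ] ℝ) × (E →L[ℝ] F) ↦
      p.1.compContinuousLinearMap p.2) := by
  let alt : ContinuousMultilinearMap ℝ (fun _ : Fin k ↦ E) ℝ →L[ℝ] E [⋀^Fin k]→L[ℝ] ℝ :=
    LinearMap.mkContinuous
      { toFun := fun f ↦ ContinuousMultilinearMap.alternatization f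
        map_add' := fun f g ↦ map_add _ f g
        map_smul' := fun c f ↦ by
          ext v
          simp [ContinuousMultilinearMap.alternatization_apply_apply, Finset.mul_sum,
            Units.smul_def, mul_left_comm] }
      (k.factorial : ℝ) norm_alternatization_le
  have key : (fun p : (F [⋀^Fin k]→L[ℝ] ℝ) × (E →L[ℝ] F) ↦ p.1.compContinuousLinearMap p.2) =
      fun p ↦ (k.factorial : ℝ)⁻¹ • alt
        (ContinuousMultilinearMap.compContinuousLinearMapContinuousMultilinear ℝ
          (fun _ : Fin k ↦ E) (fun _ ↦ F) ℝ (fun _ ↦ p.2)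
          (ContinuousAlternatingMap.toContinuousMultilinearMapCLM ℝ p.1)) := by
    funext p
    ext v
    have h : ∀ σ : Equiv.Perm (Fin k), Equiv.Perm.sign σ •
        p.1 (fun i ↦ p.2 (v (σ i))) = p.1 (fun i ↦ p.2 (v i)) := by
      intro σ
      have := p.1.toAlternatingMap.map_perm (fun i ↦ p.2 (v i)) σ
      have h2 : p.1 (fun i ↦ p.2 (v (σ i))) =
        Equiv.Perm.sign σ • p.1 (fun i ↦ p.2 (v i)) := this
      rw [h2, smul_smul, Int.units_mul_self, one_smul]
    have h3 : alt
        (ContinuousMultilinearMap.compContinuousLinearMapContinuousMultilinear ℝ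
          (fun _ : Fin k ↦ E) (fun _ ↦ F) ℝ (fun _ ↦ p.2)
          (ContinuousAlternatingMap.toContinuousMultilinearMapCLM ℝ p.1)) v =
        ∑ σ : Equiv.Perm (Fin k), Equiv.Perm.sign σ • p.1 (fun i ↦ p.2 (v (σ i))) :=
      ContinuousMultilinearMap.alternatization_apply_apply _ _
    rw [ContinuousAlternatingMap.smul_apply, h3, Finset.sum_congr rfl fun σ _ ↦ h σ]
    have : (k.factorial : ℝ) ≠ 0 := by positivity
    simp [Fintype.card_perm]
    field_simp
    rfl
  rw [key]
  have hF : ContDiff ℝ n (fun p : (F [⋀^Fin k]→L[ℝ] ℝ) × (E →L[ℝ] F) ↦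
      ContinuousMultilinearMap.compContinuousLinearMapContinuousMultilinear ℝ
        (fun _ : Fin k ↦ E) (fun _ ↦ F) ℝ (fun _ ↦ p.2)) :=
    (ContinuousMultilinearMap.contDiff _).comp (contDiff_pi.2 fun _ ↦ contDiff_snd)
  have hL : ContDiff ℝ n (fun p : (F [⋀^Fin k]→L[ℝ] ℝ) × (E →L[ℝ] F) ↦
      (ContinuousAlternatingMap.toContinuousMultilinearMapCLM ℝ p.1 :
        ContinuousMultilinearMap ℝ (fun _ : Fin k ↦ F) ℝ)) :=
    (ContinuousAlternatingMap.toContinuousMultilinearMapCLM ℝ :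
      (F [⋀^Fin k]→L[ℝ] ℝ) →L[ℝ] _).contDiff.comp contDiff_fst
  exact (alt.contDiff.comp (hF.clm_apply hL)).const_smul _

/-- `DiffForm E X k` is the real vector space `Ωᵏ(X)` of smooth differential `k`-forms on the
smooth manifold `X` (modelled on `E`, without boundary): smooth sections of the bundle whose fibre
at `x` is the space of alternating `k`-linear maps `(T_x X)ᵏ → ℝ`. -/
abbrev DiffForm (E : Type*) [NormedAddCommGroup E] [NormedSpace ℝ E]
    (X : Type*) [TopologicalSpace X] [ChartedSpace E X] [IsManifold 𝓘(ℝ, E) ∞ X] (k : ℕ) :=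
  ContMDiffSection 𝓘(ℝ, E) (E [⋀^Fin k]→L[ℝ] ℝ) ∞
    (fun x : X ↦ TangentSpace 𝓘(ℝ, E) x [⋀^Fin k]→L[ℝ] Bundle.Trivial X ℝ x)

section Forms

variable {E : Type*} [NormedAddCommGroup E] [NormedSpace ℝ E]
  {X : Type*} [TopologicalSpace X] [ChartedSpace E X] [IsManifold 𝓘(ℝ, E) ∞ X]
  {E' : Type*} [NormedAddCommGroup E'] [NormedSpace ℝ E']
  {Y : Type*} [TopologicalSpace Y] [ChartedSpace E' Y] [IsManifold 𝓘(ℝ, E') ∞ Y]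
  {k : ℕ}

theorem DiffForm.contMDiff_pullback (f : X → Y) (hf : ContMDiff 𝓘(ℝ, E) 𝓘(ℝ, E') ∞ f)
    (θ : DiffForm E' Y k) :
    ContMDiff 𝓘(ℝ, E) (𝓘(ℝ, E).prod 𝓘(ℝ, E [⋀^Fin k]→L[ℝ] ℝ)) ∞
      (fun x ↦ Bundle.TotalSpace.mk' (E [⋀^Fin k]→L[ℝ] ℝ)
        (E := fun x : X ↦ TangentSpace 𝓘(ℝ, E) x [⋀^Fin k]→L[ℝ] Bundle.Trivial X ℝ x) x
        ((θ (f x)).compContinuousLinearMap (mfderiv 𝓘(ℝ, E) 𝓘(ℝ, E') f x))) := by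
  intro x₀
  rw [Bundle.contMDiffAt_section]
  have h1 := (Bundle.contMDiffAt_section (f x₀)).1 (θ.contMDiff (f x₀))
  have h2 := h1.comp x₀ (hf x₀)
  have h3 := (hf x₀).mfderiv_const (m := ∞) (by simp)
  have h4 := (contDiff_alternating_comp (E := E) (F := E') (k := k)
    (n := ∞)).contMDiff.contMDiffAt.comp x₀ (h2.prodMk_space h3)
  refine h4.congr_of_eventuallyEq ?_
  have hb : ∀ᶠ x in nhds x₀, x ∈ (chartAt E x₀).source :=
    (chartAt E x₀).open_source.mem_nhds (mem_chart_source E x₀)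
  have hb' : ∀ᶠ x in nhds x₀, f x ∈ (chartAt E' (f x₀)).source :=
    hf.continuous.continuousAt.eventually
      ((chartAt E' (f x₀)).open_source.mem_nhds (mem_chart_source E' (f x₀)))
  filter_upwards [hb, hb'] with x hx hx'
  ext v
  simp only [FiberBundle.trivializationAt_continuousAlternatingMap_apply,
    ContinuousAlternatingMap.inCoordinates, inTangentCoordinates,
    ContinuousLinearMap.inCoordinates, Function.comp_def]
  simp
  congr 1
  funext i
  exact ((trivializationAt E' (TangentSpace 𝓘(ℝ, E')) (f x₀)).symmₗ_linearMapAt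
    (by simpa using hx') _).symm

/-- The pullback `f^* : Ωᵏ(Y) → Ωᵏ(X)` of differential forms along a smooth map `f : X → Y`:
`(f^*θ)_x(v₁, …, v_k) = θ_{f x}(df v₁, …, df v_k)`. -/
def DiffForm.pullback (f : X → Y) (hf : ContMDiff 𝓘(ℝ, E) 𝓘(ℝ, E') ∞ f) :
    DiffForm E' Y k →ₗ[ℝ] DiffForm E X k where
  toFun θ := ⟨fun x ↦ (θ (f x)).compContinuousLinearMap (mfderiv 𝓘(ℝ, E) 𝓘(ℝ, E') f x),
    DiffForm.contMDiff_pullback f hf θ⟩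
  map_add' _ _ := rfl
  map_smul' _ _ := rfl

end Forms

/-! ### Lie groupoids -/

/-- A Lie groupoid `G ⇉ M` with source `src`, target `tgt`, unit map `one`, inversion `inv` and
multiplication `mul`. The arrows `g`, `h` are composable when `src g = tgt h`, and then their
product is `mul (g, h)`; the values of `mul` at pairs that are not composable play no role.
Source and target are surjective submersions, so that the set of composable pairs is an embedded
submanifold of `G × G`, and smoothness of the multiplication on this submanifold is `ContMDiffOn`
(a function on an embedded submanifold is smooth iff it extends locally to a smooth function). -/
structure LieGroupoid (EG : Type*) [NormedAddCommGroup EG] [NormedSpace ℝ EG]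
    (G : Type*) [TopologicalSpace G] [ChartedSpace EG G]
    (EM : Type*) [NormedAddCommGroup EM] [NormedSpace ℝ EM]
    (M : Type*) [TopologicalSpace M] [ChartedSpace EM M] where
  src : G → M
  tgt : G → M
  one : M → G
  inv : G → G
  mul : G × G → G
  src_one : ∀ x, src (one x) = x
  tgt_one : ∀ x, tgt (one x) = x
  src_mul : ∀ g h, src g = tgt h → src (mul (g, h)) = src h
  tgt_mul : ∀ g h, src g = tgt h → tgt (mul (g, h)) = tgt g
  mul_assoc : ∀ g h l, src g = tgt h → src h = tgt l →
    mul (mul (g, h), l) = mul (g, mul (h, l))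
  one_mul : ∀ g, mul (one (tgt g), g) = g
  mul_one : ∀ g, mul (g, one (src g)) = g
  src_inv : ∀ g, src (inv g) = tgt g
  tgt_inv : ∀ g, tgt (inv g) = src g
  inv_mul : ∀ g, mul (inv g, g) = one (src g)
  mul_inv : ∀ g, mul (g, inv g) = one (tgt g)
  isSubmersion_src : Manifold.IsSubmersion 𝓘(ℝ, EG) 𝓘(ℝ, EM) ∞ src
  isSubmersion_tgt : Manifold.IsSubmersion 𝓘(ℝ, EG) 𝓘(ℝ, EM) ∞ tgt
  contMDiff_one : ContMDiff 𝓘(ℝ, EM) 𝓘(ℝ, EG) ∞ one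
  contMDiff_inv : ContMDiff 𝓘(ℝ, EG) 𝓘(ℝ, EG) ∞ inv
  contMDiffOn_mul : ContMDiffOn (𝓘(ℝ, EG).prod 𝓘(ℝ, EG)) 𝓘(ℝ, EG) ∞ mul
    {p : G × G | src p.1 = tgt p.2}

namespace LieGroupoid

variable {EG : Type*} [NormedAddCommGroup EG] [NormedSpace ℝ EG]
  {G : Type*} [TopologicalSpace G] [ChartedSpace EG G] [IsManifold 𝓘(ℝ, EG) ∞ G]
  {EM : Type*} [NormedAddCommGroup EM] [NormedSpace ℝ EM]
  {M : Type*} [TopologicalSpace M] [ChartedSpace EM M] [IsManifold 𝓘(ℝ, EM) ∞ M]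
  (𝒢 : LieGroupoid EG G EM M) {k : ℕ}

/-- The set `G⁽²⁾` of composable pairs. -/
def composable : Set (G × G) := {p | 𝒢.src p.1 = 𝒢.tgt p.2}

/-- The pullback `s^* : Ωᵏ(M) → Ωᵏ(G)` along the source map. -/
def srcPullback : DiffForm EM M k →ₗ[ℝ] DiffForm EG G k :=
  DiffForm.pullback 𝒢.src 𝒢.isSubmersion_src.contMDiff

/-- The pullback `t^* : Ωᵏ(M) → Ωᵏ(G)` along the target map. -/
def tgtPullback : DiffForm EM M k →ₗ[ℝ] DiffForm EG G k :=
  DiffForm.pullback 𝒢.tgt 𝒢.isSubmersion_tgt.contMDiff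

/-- The pullback `ι^* : Ωᵏ(G) → Ωᵏ(M)` along the inclusion `ι : M → G` of the units. -/
def unitPullback : DiffForm EG G k →ₗ[ℝ] DiffForm EM M k :=
  DiffForm.pullback 𝒢.one 𝒢.contMDiff_one

/-- A pair `(X, Y) ∈ T_g G × T_h G` is tangent to `G⁽²⁾` at the composable pair `(g, h)`, that is,
composable in the tangent groupoid, iff `ds X = dt Y`. -/
def TangentComposable {g h : G} (X : TangentSpace 𝓘(ℝ, EG) g) (Y : TangentSpace 𝓘(ℝ, EG) h) :
    Prop :=
  tangentMap 𝓘(ℝ, EG) 𝓘(ℝ, EM) 𝒢.src ⟨g, X⟩ = tangentMap 𝓘(ℝ, EG) 𝓘(ℝ, EM) 𝒢.tgt ⟨h, Y⟩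

/-- The product `X · Y = dm(X, Y) ∈ T_{gh} G` of a pair `(X, Y)` tangent to `G⁽²⁾` at `(g, h)`,
where `dm` is the derivative of the multiplication `m` along `G⁽²⁾`. The vector `dm(X, Y)` is the
same for every derivative of `m` within `G⁽²⁾`, because `(X, Y)` is tangent to `G⁽²⁾`. -/
def tangentMul {g h : G} (X : TangentSpace 𝓘(ℝ, EG) g) (Y : TangentSpace 𝓘(ℝ, EG) h) :
    TangentSpace 𝓘(ℝ, EG) (𝒢.mul (g, h)) :=
  mfderivWithin (𝓘(ℝ, EG).prod 𝓘(ℝ, EG)) 𝓘(ℝ, EG) 𝒢.mul 𝒢.composable (g, h) (X, Y)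

/-- `Θ ∈ Ωᵏ(G)` is multiplicative if `m^*Θ = pr₁^*Θ + pr₂^*Θ` on `G⁽²⁾`; this equality of
`k`-forms is evaluated at all `k`-tuples `(X i, Y i)` of tangent vectors of `G⁽²⁾`. -/
def IsMultiplicative (Θ : DiffForm EG G k) : Prop :=
  ∀ (g h : G), (g, h) ∈ 𝒢.composable →
    ∀ (X : Fin k → TangentSpace 𝓘(ℝ, EG) g) (Y : Fin k → TangentSpace 𝓘(ℝ, EG) h),
      (∀ i, 𝒢.TangentComposable (X i) (Y i)) →
      (Θ (𝒢.mul (g, h)) (fun i ↦ 𝒢.tangentMul (X i) (Y i)) : ℝ) = (Θ g X : ℝ) + (Θ h Y : ℝ)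

/-- `Θ ∈ Ωᵏ(G)` is affine if `m^*Θ = pr₁^*Θ + pr₂^*Θ - pr₁^*s^*θ` on `G⁽²⁾`, where `θ = ι^*Θ`. -/
def IsAffine (Θ : DiffForm EG G k) : Prop :=
  ∀ (g h : G), (g, h) ∈ 𝒢.composable →
    ∀ (X : Fin k → TangentSpace 𝓘(ℝ, EG) g) (Y : Fin k → TangentSpace 𝓘(ℝ, EG) h),
      (∀ i, 𝒢.TangentComposable (X i) (Y i)) →
      (Θ (𝒢.mul (g, h)) (fun i ↦ 𝒢.tangentMul (X i) (Y i)) : ℝ) =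
        (Θ g X : ℝ) + (Θ h Y : ℝ) - (𝒢.srcPullback (𝒢.unitPullback Θ) g X : ℝ)

variable (k) in
/-- The vector space of multiplicative `k`-forms. -/
def multForms : Submodule ℝ (DiffForm EG G k) where
  carrier := {Θ | 𝒢.IsMultiplicative Θ}
  zero_mem' := fun g h _ X Y _ ↦ (add_zero (0 : ℝ)).symm
  add_mem' := fun {Θ Θ'} hΘ hΘ' g h hgh X Y hXY ↦ by
    have h1 := hΘ g h hgh X Y hXY
    have h2 := hΘ' g h hgh X Y hXY
    calc _ = (Θ (𝒢.mul (g, h)) (fun i ↦ 𝒢.tangentMul (X i) (Y i)) : ℝ) +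
          (Θ' (𝒢.mul (g, h)) (fun i ↦ 𝒢.tangentMul (X i) (Y i)) : ℝ) := rfl
      _ = ((Θ g X : ℝ) + (Θ' g X : ℝ)) + ((Θ h Y : ℝ) + (Θ' h Y : ℝ)) := by rw [h1, h2]; ring
  smul_mem' := fun c Θ hΘ g h hgh X Y hXY ↦ by
    have h1 := hΘ g h hgh X Y hXY
    calc _ = c * (Θ (𝒢.mul (g, h)) (fun i ↦ 𝒢.tangentMul (X i) (Y i)) : ℝ) := rfl
      _ = c * (Θ g X : ℝ) + c * (Θ h Y : ℝ) := by rw [h1]; ring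

variable (k) in
/-- The vector space of affine `k`-forms. -/
def affForms : Submodule ℝ (DiffForm EG G k) where
  carrier := {Θ | 𝒢.IsAffine Θ}
  zero_mem' := fun g h _ X Y _ ↦ show (0 : ℝ) = 0 + 0 - 0 by ring
  add_mem' := fun {Θ Θ'} hΘ hΘ' g h hgh X Y hXY ↦ by
    have h1 := hΘ g h hgh X Y hXY
    have h2 := hΘ' g h hgh X Y hXY
    calc _ = (Θ (𝒢.mul (g, h)) (fun i ↦ 𝒢.tangentMul (X i) (Y i)) : ℝ) +
          (Θ' (𝒢.mul (g, h)) (fun i ↦ 𝒢.tangentMul (X i) (Y i)) : ℝ) := rfl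
      _ = ((Θ g X : ℝ) + (Θ' g X : ℝ)) + ((Θ h Y : ℝ) + (Θ' h Y : ℝ)) -
          ((𝒢.srcPullback (𝒢.unitPullback Θ) g X : ℝ) +
            (𝒢.srcPullback (𝒢.unitPullback Θ') g X : ℝ)) := by rw [h1, h2]; ring
  smul_mem' := fun c Θ hΘ g h hgh X Y hXY ↦ by
    have h1 := hΘ g h hgh X Y hXY
    calc _ = c * (Θ (𝒢.mul (g, h)) (fun i ↦ 𝒢.tangentMul (X i) (Y i)) : ℝ) := rfl
      _ = c * (Θ g X : ℝ) + c * (Θ h Y : ℝ) -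
          c * (𝒢.srcPullback (𝒢.unitPullback Θ) g X : ℝ) := by rw [h1]; ring

end LieGroupoid

/-! ### 2-vector spaces -/

/-- A structure of 2-vector space `V₁ ⇉ V₀` (a category internal to vector spaces): `V₁` is the
space of arrows, `V₀` the space of objects; source, target, identity-assigning map and composition
are linear. The composite `comp (f, g)` is defined when `src f = tgt g` (first `g`, then `f`). -/
structure TwoVectorSpace (K V₁ V₀ : Type*) [Field K] [AddCommGroup V₁] [Module K V₁]
    [AddCommGroup V₀] [Module K V₀] where
  src : V₁ →ₗ[K] V₀
  tgt : V₁ →ₗ[K] V₀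
  ident : V₀ →ₗ[K] V₁
  comp : LinearMap.eqLocus (src ∘ₗ LinearMap.fst K V₁ V₁) (tgt ∘ₗ LinearMap.snd K V₁ V₁) →ₗ[K] V₁
  src_ident : ∀ x, src (ident x) = x
  tgt_ident : ∀ x, tgt (ident x) = x
  src_comp : ∀ (f g : V₁) (h : src f = tgt g), src (comp ⟨(f, g), h⟩) = src g
  tgt_comp : ∀ (f g : V₁) (h : src f = tgt g), tgt (comp ⟨(f, g), h⟩) = tgt f
  ident_comp : ∀ f : V₁, comp ⟨(ident (tgt f), f), src_ident (tgt f)⟩ = f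
  comp_ident : ∀ f : V₁, comp ⟨(f, ident (src f)), (tgt_ident (src f)).symm⟩ = f
  assoc : ∀ (f g l : V₁) (h₁ : src f = tgt g) (h₂ : src g = tgt l),
    comp ⟨(comp ⟨(f, g), h₁⟩, l), (src_comp f g h₁).trans h₂⟩ =
      comp ⟨(f, comp ⟨(g, l), h₂⟩), h₁.trans (tgt_comp g l h₂).symm⟩

/-- The underlying category of a 2-vector space is a groupoid: every arrow is invertible. -/
def TwoVectorSpace.IsGroupoid {K V₁ V₀ : Type*} [Field K] [AddCommGroup V₁] [Module K V₁]
    [AddCommGroup V₀] [Module K V₀] (C : TwoVectorSpace K V₁ V₀) : Prop :=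
  ∀ f : V₁, ∃ (g : V₁) (h₁ : C.src f = C.tgt g) (h₂ : C.src g = C.tgt f),
    C.comp ⟨(f, g), h₁⟩ = C.ident (C.tgt f) ∧ C.comp ⟨(g, f), h₂⟩ = C.ident (C.src f)

end

/-!
Everything reduces to how multiplicative and affine forms interact with the pullbacks `s^*θ`, `t^*θ`
of forms `θ` on the base. On `G⁽²⁾` one has `s ∘ m = s ∘ pr₂`, `t ∘ m = t ∘ pr₁` and
`s ∘ pr₁ = t ∘ pr₂`, hence `m^*s^*θ = pr₂^*s^*θ`, `m^*t^*θ = pr₁^*t^*θ` and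
`pr₁^*s^*θ = pr₂^*t^*θ`; moreover `ι^*s^*θ = ι^*t^*θ = θ`. It follows that `s^*θ` and `t^*θ` are
affine (`isAffine_srcPullback`, `isAffine_tgtPullback`), so that `Θ - s^*ι^*Θ` and `Θ - t^*ι^*Θ` are
affine and killed by `ι^*`. A multiplicative form is killed by `ι^*`, because `m` restricts to the
identity on units, and an affine form killed by `ι^*` is visibly multiplicative: multiplicative
forms are exactly the affine forms in the kernel of `ι^*`. With these facts, the axioms of a 2-vector
space are linear algebra, and the inverse of `Θ` is `Θ - s^*θ - t^*θ` with `θ = ι^*Θ`.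

The analytic content is in the first two identities. The product of tangent vectors is defined by
some derivative of `m` within `G⁽²⁾`, and the chain rule along `G⁽²⁾` determines
`ds (dm (X, Y))` only if derivatives within `G⁽²⁾` are unique on the pairs with `ds X = dt Y`. This
is `eq_of_hasMFDerivWithinAt_composable`: the normal form of the submersion `s` provides a smooth
map of a neighbourhood of `(g, h)` in `G × G` into `G⁽²⁾` that fixes `(g, h)` and whose derivative
fixes all such pairs `(X, Y)`, so that derivatives within `G⁽²⁾` can be compared with honest
derivatives on an open set.
-/

/-! ### Local transport between the fibres of a submersion -/

section Submersion

open Topology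

variable {E : Type*} [NormedAddCommGroup E] [NormedSpace ℝ E]
  {X : Type*} [TopologicalSpace X] [ChartedSpace E X]
  {E' : Type*} [NormedAddCommGroup E'] [NormedSpace ℝ E']
  {Y : Type*} [TopologicalSpace Y] [ChartedSpace E' Y]

/-- Near a point `x`, the points of `X` can be moved smoothly into prescribed fibres of a submersion
`f`: `r (x', y)` lies in the fibre over `y`, and `x'` is not moved if it lies there already. In
submersion charts `(u, v) ↦ u`, the map `r` replaces the coordinate `u` of `x'` by that of `y`. -/
theorem Manifold.IsSubmersionAt.exists_fiberTransport {f : X → Y} {x : X}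
    (hf : Manifold.IsSubmersionAt 𝓘(ℝ, E) 𝓘(ℝ, E') ∞ f x) :
    ∃ r : X × Y → X,
      ContMDiffAt (𝓘(ℝ, E).prod 𝓘(ℝ, E')) 𝓘(ℝ, E) ∞ r (x, f x) ∧
      (∀ᶠ x' in 𝓝 x, r (x', f x') = x') ∧
      ∀ᶠ q in 𝓝 (x, f x), f (r q) = q.2 := by
  let φ := hf.domChart
  let ψ := hf.codChart
  let e := hf.equiv
  have hw : ∀ u ∈ φ.target, ψ (f (φ.symm u)) = (e u).1 := fun u hu ↦ by
    have hu' : u ∈ (hf.domChart.extend 𝓘(ℝ, E)).target := by simpa [φ] using hu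
    exact hf.writtenInCharts hu'
  have hxφ : x ∈ φ.source := hf.mem_domChart_source
  have hfψ : f x ∈ ψ.source := hf.mem_codChart_source
  have hφψ : ∀ x' ∈ φ.source, f x' ∈ ψ.source := fun x' hx' ↦ hf.source_subset_preimage_source hx'
  have hw' : ∀ x' ∈ φ.source, ψ (f x') = (e (φ x')).1 := fun x' hx' ↦ by
    simpa [φ.left_inv hx'] using hw (φ x') (φ.map_source hx')
  let w : X × Y → E := fun q ↦ e.symm (ψ q.2, (e (φ q.1)).2)
  have hwx : ∀ x' ∈ φ.source, w (x', f x') = φ x' := fun x' hx' ↦ by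
    simp only [w, hw' x' hx']
    exact e.symm_apply_apply _
  have hφs : ContMDiffAt 𝓘(ℝ, E) 𝓘(ℝ, E) ∞ φ x :=
    contMDiffAt_of_mem_maximalAtlas hf.domChart_mem_maximalAtlas hxφ
  have hψs : ContMDiffAt 𝓘(ℝ, E') 𝓘(ℝ, E') ∞ ψ (f x) :=
    contMDiffAt_of_mem_maximalAtlas hf.codChart_mem_maximalAtlas hfψ
  have hws : ContMDiffAt (𝓘(ℝ, E).prod 𝓘(ℝ, E')) 𝓘(ℝ, E) ∞ w (x, f x) := by
    have h1 : ContMDiffAt (𝓘(ℝ, E).prod 𝓘(ℝ, E')) 𝓘(ℝ, E) ∞ (fun q : X × Y ↦ φ q.1) (x, f x) :=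
      ContMDiffAt.comp (x, f x) (g := φ) (f := Prod.fst) hφs contMDiffAt_fst
    have h2 : ContMDiffAt (𝓘(ℝ, E).prod 𝓘(ℝ, E')) 𝓘(ℝ, E') ∞ (fun q : X × Y ↦ ψ q.2) (x, f x) :=
      ContMDiffAt.comp (x, f x) (g := ψ) (f := Prod.snd) hψs contMDiffAt_snd
    have h3 : ContDiff ℝ ∞ (fun p : E' × E ↦ e.symm (p.1, (e p.2).2)) := by fun_prop
    exact h3.contMDiff.contMDiffAt.comp (x, f x) (h2.prodMk_space h1)
  have hwt : ∀ᶠ q in 𝓝 (x, f x), w q ∈ φ.target :=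
    hws.continuousAt.eventually_mem
      (φ.open_target.mem_nhds (by rw [hwx x hxφ]; exact φ.map_source hxφ))
  refine ⟨fun q ↦ φ.symm (w q), ?_, ?_, ?_⟩
  · refine ContMDiffAt.comp (x, f x) (g := φ.symm) ?_ hws
    rw [hwx x hxφ]
    exact contMDiffAt_symm_of_mem_maximalAtlas hf.domChart_mem_maximalAtlas (φ.map_source hxφ)
  · filter_upwards [φ.open_source.mem_nhds hxφ] with x' hx'
    rw [hwx x' hx', φ.left_inv hx']
  · have hψ : ∀ᶠ q in 𝓝 (x, f x), q.2 ∈ ψ.source :=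
      continuousAt_snd.eventually_mem (ψ.open_source.mem_nhds hfψ)
    filter_upwards [hwt, hψ] with q hq hq2
    have h1 : ψ (f (φ.symm (w q))) = ψ q.2 := by
      rw [hw _ hq]
      simp [w]
    exact ψ.injOn (hφψ _ (φ.map_target hq)) hq2 h1

/-- The first-order form of `exists_fiberTransport`: the derivative of `r` sends `(v, df v)` to `v`.
The point `y = f x` is kept as a separate variable, since in the application it is the target of
another arrow, equal to `f x` only propositionally. -/
theorem Manifold.IsSubmersionAt.exists_fiberTransport_hasMFDerivAt {f : X → Y} {x : X} {y : Y}
    (hf : Manifold.IsSubmersionAt 𝓘(ℝ, E) 𝓘(ℝ, E') ∞ f x) (hy : f x = y) :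
    ∃ (r : X × Y → X) (R : E × E' →L[ℝ] E), r (x, y) = x ∧
      HasMFDerivAt (𝓘(ℝ, E).prod 𝓘(ℝ, E')) 𝓘(ℝ, E) r (x, y) R ∧
      (∀ v : E, R (v, (mfderiv 𝓘(ℝ, E) 𝓘(ℝ, E') f x : E →L[ℝ] E') v) = v) ∧
      ∀ᶠ q in 𝓝 (x, y), f (r q) = q.2 := by
  subst hy
  obtain ⟨r, hr, hr1, hr2⟩ := hf.exists_fiberTransport
  have hR := (hr.mdifferentiableAt (by simp)).hasMFDerivAt
  refine ⟨r, mfderiv (𝓘(ℝ, E).prod 𝓘(ℝ, E')) 𝓘(ℝ, E) r (x, f x), hr1.self_of_nhds, hR, ?_, hr2⟩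
  have hfd := (hf.contMDiffAt.mdifferentiableAt (by simp)).hasMFDerivAt
  have h1 := HasMFDerivAt.comp x hR ((hasMFDerivAt_id x).prodMk hfd)
  have h2 : HasMFDerivAt 𝓘(ℝ, E) 𝓘(ℝ, E) (r ∘ fun x' ↦ (id x', f x')) x
      (ContinuousLinearMap.id ℝ E) :=
    (hasMFDerivAt_id x).congr_of_eventuallyEq hr1
  intro v
  exact DFunLike.congr_fun (hasMFDerivAt_unique h1 h2) v

end Submersion

/-! ### Derivatives along the composable pairs -/

/-- The chain rule for an outer function differentiable within `s` and an inner function that maps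
a neighbourhood into `s`: the composite is differentiable without restriction. The base point
`y = f x` is a separate variable, because it is often given in another form. -/
theorem HasMFDerivWithinAt.comp_hasMFDerivAt_of_eventually_mem
    {E : Type*} [NormedAddCommGroup E] [NormedSpace ℝ E] {H : Type*} [TopologicalSpace H]
    {I : ModelWithCorners ℝ E H} {X : Type*} [TopologicalSpace X] [ChartedSpace H X]
    {E' : Type*} [NormedAddCommGroup E'] [NormedSpace ℝ E'] {H' : Type*} [TopologicalSpace H']
    {I' : ModelWithCorners ℝ E' H'} {Y : Type*} [TopologicalSpace Y] [ChartedSpace H' Y]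
    {E'' : Type*} [NormedAddCommGroup E''] [NormedSpace ℝ E''] {H'' : Type*} [TopologicalSpace H'']
    {I'' : ModelWithCorners ℝ E'' H''} {Z : Type*} [TopologicalSpace Z] [ChartedSpace H'' Z]
    {φ : Y → Z} {f : X → Y} {s : Set Y} {x : X} {y : Y} {A : E' →L[ℝ] E''} {B : E →L[ℝ] E'}
    (hφ : HasMFDerivWithinAt I' I'' φ s y A) (hf : HasMFDerivAt I I' f x B) (hy : f x = y)
    (hs : ∀ᶠ x' in nhds x, f x' ∈ s) :
    HasMFDerivAt I I'' (φ ∘ f) x (A ∘L B) := by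
  subst hy
  have h := HasMFDerivWithinAt.comp x hφ (hf.hasMFDerivWithinAt (s := f ⁻¹' s)) subset_rfl
  exact h.hasMFDerivAt hs

theorem TangentBundle.mk_eq_mk {E : Type*} [NormedAddCommGroup E] [NormedSpace ℝ E]
    {X : Type*} [TopologicalSpace X] [ChartedSpace E X] {x y : X} (h : x = y) {v w : E}
    (hv : v = w) :
    (⟨x, v⟩ : TangentBundle 𝓘(ℝ, E) X) = ⟨y, w⟩ := by
  subst h hv; rfl

theorem TangentBundle.snd_eq_snd {E : Type*} [NormedAddCommGroup E] [NormedSpace ℝ E]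
    {X : Type*} [TopologicalSpace X] [ChartedSpace E X]
    {p q : TangentBundle 𝓘(ℝ, E) X} (h : p = q) : (p.2 : E) = (q.2 : E) := by
  subst h; rfl

namespace LieGroupoid

variable {EG : Type*} [NormedAddCommGroup EG] [NormedSpace ℝ EG]
  {G : Type*} [TopologicalSpace G] [ChartedSpace EG G]
  {EM : Type*} [NormedAddCommGroup EM] [NormedSpace ℝ EM]
  {M : Type*} [TopologicalSpace M] [ChartedSpace EM M]
  (𝒢 : LieGroupoid EG G EM M) {k : ℕ}

theorem hasMFDerivAt_src (g : G) : HasMFDerivAt 𝓘(ℝ, EG) 𝓘(ℝ, EM) 𝒢.src g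
    (mfderiv 𝓘(ℝ, EG) 𝓘(ℝ, EM) 𝒢.src g) :=
  ((𝒢.isSubmersion_src.contMDiff g).mdifferentiableAt (by simp)).hasMFDerivAt

theorem hasMFDerivAt_tgt (g : G) : HasMFDerivAt 𝓘(ℝ, EG) 𝓘(ℝ, EM) 𝒢.tgt g
    (mfderiv 𝓘(ℝ, EG) 𝓘(ℝ, EM) 𝒢.tgt g) :=
  ((𝒢.isSubmersion_tgt.contMDiff g).mdifferentiableAt (by simp)).hasMFDerivAt

theorem hasMFDerivAt_one (x : M) : HasMFDerivAt 𝓘(ℝ, EM) 𝓘(ℝ, EG) 𝒢.one x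
    (mfderiv 𝓘(ℝ, EM) 𝓘(ℝ, EG) 𝒢.one x) :=
  ((𝒢.contMDiff_one x).mdifferentiableAt (by simp)).hasMFDerivAt

theorem hasMFDerivWithinAt_mul {p : G × G} (hp : p ∈ 𝒢.composable) :
    HasMFDerivWithinAt (𝓘(ℝ, EG).prod 𝓘(ℝ, EG)) 𝓘(ℝ, EG) 𝒢.mul 𝒢.composable p
      (mfderivWithin (𝓘(ℝ, EG).prod 𝓘(ℝ, EG)) 𝓘(ℝ, EG) 𝒢.mul 𝒢.composable p) :=
  ((𝒢.contMDiffOn_mul p hp).mdifferentiableWithinAt (by simp)).hasMFDerivWithinAt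

theorem TangentComposable.mfderiv_eq {g h : G} {X : TangentSpace 𝓘(ℝ, EG) g}
    {Y : TangentSpace 𝓘(ℝ, EG) h} (hXY : 𝒢.TangentComposable X Y) :
    (mfderiv 𝓘(ℝ, EG) 𝓘(ℝ, EM) 𝒢.src g : EG →L[ℝ] EM) X =
      (mfderiv 𝓘(ℝ, EG) 𝓘(ℝ, EM) 𝒢.tgt h : EG →L[ℝ] EM) Y :=
  TangentBundle.snd_eq_snd hXY

/-- Two derivatives of a map within `G⁽²⁾` agree on all pairs `(X, Y)` with `ds X = dt Y`; that is,
the linear condition `ds X = dt Y` describes genuine tangent vectors of `G⁽²⁾`. -/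
theorem eq_of_hasMFDerivWithinAt_composable
    {E : Type*} [NormedAddCommGroup E] [NormedSpace ℝ E] {H : Type*} [TopologicalSpace H]
    {I : ModelWithCorners ℝ E H} {Z : Type*} [TopologicalSpace Z] [ChartedSpace H Z]
    {φ : G × G → Z} {g h : G} (hgh : (g, h) ∈ 𝒢.composable) {A B : EG × EG →L[ℝ] E}
    (hA : HasMFDerivWithinAt (𝓘(ℝ, EG).prod 𝓘(ℝ, EG)) I φ 𝒢.composable (g, h) A)
    (hB : HasMFDerivWithinAt (𝓘(ℝ, EG).prod 𝓘(ℝ, EG)) I φ 𝒢.composable (g, h) B)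
    {X : TangentSpace 𝓘(ℝ, EG) g} {Y : TangentSpace 𝓘(ℝ, EG) h}
    (hXY : 𝒢.TangentComposable X Y) : A (X, Y) = B (X, Y) := by
  -- `F (g', h') = (r (g', t h'), h')` maps a neighbourhood of `(g, h)` into `G⁽²⁾`, fixes `(g, h)`,
  -- and its derivative fixes `(X, Y)`.
  obtain ⟨r, R, hrg, hR, hRv, hr⟩ :=
    (𝒢.isSubmersion_src.isSubmersionAt g).exists_fiberTransport_hasMFDerivAt (y := 𝒢.tgt h) hgh
  have hd : HasMFDerivAt (𝓘(ℝ, EG).prod 𝓘(ℝ, EG)) (𝓘(ℝ, EG).prod 𝓘(ℝ, EM))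
      (fun p : G × G ↦ (p.1, 𝒢.tgt p.2)) (g, h) _ :=
    HasMFDerivAt.prodMk (hasMFDerivAt_fst (g, h))
      (HasMFDerivAt.comp (g, h) (𝒢.hasMFDerivAt_tgt h) (hasMFDerivAt_snd (g, h)))
  have hF := HasMFDerivAt.prodMk (HasMFDerivAt.comp (g, h) hR hd) (hasMFDerivAt_snd (g, h))
  have hFp : ((r ∘ fun p : G × G ↦ (p.1, 𝒢.tgt p.2)) (g, h), (g, h).2) = (g, h) :=
    Prod.ext hrg rfl
  have hmem : ∀ᶠ p : G × G in nhds (g, h),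
      ((r ∘ fun p : G × G ↦ (p.1, 𝒢.tgt p.2)) p, p.2) ∈ 𝒢.composable :=
    hd.continuousAt.eventually hr
  have hAB := hasMFDerivAt_unique (hA.comp_hasMFDerivAt_of_eventually_mem hF hFp hmem)
    (hB.comp_hasMFDerivAt_of_eventually_mem hF hFp hmem)
  have hX : R (X, (mfderiv 𝓘(ℝ, EG) 𝓘(ℝ, EM) 𝒢.tgt h : EG →L[ℝ] EM) Y) = X := by
    rw [← TangentComposable.mfderiv_eq 𝒢 hXY]
    exact hRv X
  have h1 : A (R (X, (mfderiv 𝓘(ℝ, EG) 𝓘(ℝ, EM) 𝒢.tgt h : EG →L[ℝ] EM) Y), Y) =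
      B (R (X, (mfderiv 𝓘(ℝ, EG) 𝓘(ℝ, EM) 𝒢.tgt h : EG →L[ℝ] EM) Y), Y) :=
    DFunLike.congr_fun hAB (X, Y)
  rwa [hX] at h1

theorem tangentMap_src_tangentMul {g h : G} (hgh : (g, h) ∈ 𝒢.composable)
    {X : TangentSpace 𝓘(ℝ, EG) g} {Y : TangentSpace 𝓘(ℝ, EG) h}
    (hXY : 𝒢.TangentComposable X Y) :
    tangentMap 𝓘(ℝ, EG) 𝓘(ℝ, EM) 𝒢.src ⟨𝒢.mul (g, h), 𝒢.tangentMul X Y⟩ =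
      tangentMap 𝓘(ℝ, EG) 𝓘(ℝ, EM) 𝒢.src ⟨h, Y⟩ := by
  have h1 := HasMFDerivAt.comp_hasMFDerivWithinAt (g, h) (𝒢.hasMFDerivAt_src (𝒢.mul (g, h)))
    (𝒢.hasMFDerivWithinAt_mul hgh)
  have h2 := (HasMFDerivAt.comp (g, h) (𝒢.hasMFDerivAt_src h)
    (hasMFDerivAt_snd (I := 𝓘(ℝ, EG)) (I' := 𝓘(ℝ, EG)) (g, h))).hasMFDerivWithinAt
      (s := 𝒢.composable)
  have h3 := h2.congr_mono (f₁ := 𝒢.src ∘ 𝒢.mul) (fun p hp ↦ 𝒢.src_mul p.1 p.2 hp)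
    (𝒢.src_mul g h hgh) subset_rfl
  exact TangentBundle.mk_eq_mk (𝒢.src_mul g h hgh)
    (𝒢.eq_of_hasMFDerivWithinAt_composable hgh h1 h3 hXY)

theorem tangentMap_tgt_tangentMul {g h : G} (hgh : (g, h) ∈ 𝒢.composable)
    {X : TangentSpace 𝓘(ℝ, EG) g} {Y : TangentSpace 𝓘(ℝ, EG) h}
    (hXY : 𝒢.TangentComposable X Y) :
    tangentMap 𝓘(ℝ, EG) 𝓘(ℝ, EM) 𝒢.tgt ⟨𝒢.mul (g, h), 𝒢.tangentMul X Y⟩ =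
      tangentMap 𝓘(ℝ, EG) 𝓘(ℝ, EM) 𝒢.tgt ⟨g, X⟩ := by
  have h1 := HasMFDerivAt.comp_hasMFDerivWithinAt (g, h) (𝒢.hasMFDerivAt_tgt (𝒢.mul (g, h)))
    (𝒢.hasMFDerivWithinAt_mul hgh)
  have h2 := (HasMFDerivAt.comp (g, h) (𝒢.hasMFDerivAt_tgt g)
    (hasMFDerivAt_fst (I := 𝓘(ℝ, EG)) (I' := 𝓘(ℝ, EG)) (g, h))).hasMFDerivWithinAt
      (s := 𝒢.composable)
  have h3 := h2.congr_mono (f₁ := 𝒢.tgt ∘ 𝒢.mul) (fun p hp ↦ 𝒢.tgt_mul p.1 p.2 hp)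
    (𝒢.tgt_mul g h hgh) subset_rfl
  exact TangentBundle.mk_eq_mk (𝒢.tgt_mul g h hgh)
    (𝒢.eq_of_hasMFDerivWithinAt_composable hgh h1 h3 hXY)

theorem tangentMap_src_tangentMap_one (p : TangentBundle 𝓘(ℝ, EM) M) :
    tangentMap 𝓘(ℝ, EG) 𝓘(ℝ, EM) 𝒢.src (tangentMap 𝓘(ℝ, EM) 𝓘(ℝ, EG) 𝒢.one p) = p := by
  have h1 := HasMFDerivAt.comp p.1 (𝒢.hasMFDerivAt_src (𝒢.one p.1)) (𝒢.hasMFDerivAt_one p.1)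
  have h2 := (hasMFDerivAt_id (I := 𝓘(ℝ, EM)) p.1).congr_of_eventuallyEq
    (f₁ := 𝒢.src ∘ 𝒢.one) (Filter.Eventually.of_forall 𝒢.src_one)
  exact TangentBundle.mk_eq_mk (𝒢.src_one p.1) (DFunLike.congr_fun (hasMFDerivAt_unique h1 h2) p.2)

theorem tangentMap_tgt_tangentMap_one (p : TangentBundle 𝓘(ℝ, EM) M) :
    tangentMap 𝓘(ℝ, EG) 𝓘(ℝ, EM) 𝒢.tgt (tangentMap 𝓘(ℝ, EM) 𝓘(ℝ, EG) 𝒢.one p) = p := by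
  have h1 := HasMFDerivAt.comp p.1 (𝒢.hasMFDerivAt_tgt (𝒢.one p.1)) (𝒢.hasMFDerivAt_one p.1)
  have h2 := (hasMFDerivAt_id (I := 𝓘(ℝ, EM)) p.1).congr_of_eventuallyEq
    (f₁ := 𝒢.tgt ∘ 𝒢.one) (Filter.Eventually.of_forall 𝒢.tgt_one)
  exact TangentBundle.mk_eq_mk (𝒢.tgt_one p.1) (DFunLike.congr_fun (hasMFDerivAt_unique h1 h2) p.2)

theorem one_one_mem_composable (x : M) : (𝒢.one x, 𝒢.one x) ∈ 𝒢.composable :=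
  (𝒢.src_one x).trans (𝒢.tgt_one x).symm

theorem mul_one_one (x : M) : 𝒢.mul (𝒢.one x, 𝒢.one x) = 𝒢.one x := by
  simpa [𝒢.src_one] using 𝒢.mul_one (𝒢.one x)

/-- Unit tangent vectors are idempotent in the tangent groupoid: differentiate `1ₓ 1ₓ = 1ₓ`. -/
theorem tangentMul_mfderiv_one (x : M) (v : TangentSpace 𝓘(ℝ, EM) x) :
    (⟨𝒢.mul (𝒢.one x, 𝒢.one x), 𝒢.tangentMul (mfderiv 𝓘(ℝ, EM) 𝓘(ℝ, EG) 𝒢.one x v)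
      (mfderiv 𝓘(ℝ, EM) 𝓘(ℝ, EG) 𝒢.one x v)⟩ : TangentBundle 𝓘(ℝ, EG) G) =
      ⟨𝒢.one x, mfderiv 𝓘(ℝ, EM) 𝓘(ℝ, EG) 𝒢.one x v⟩ := by
  have h1 := (𝒢.hasMFDerivWithinAt_mul
    (𝒢.one_one_mem_composable x)).comp_hasMFDerivAt_of_eventually_mem
      ((𝒢.hasMFDerivAt_one x).prodMk (𝒢.hasMFDerivAt_one x)) rfl
      (Filter.Eventually.of_forall 𝒢.one_one_mem_composable)
  have h2 := (𝒢.hasMFDerivAt_one x).congr_of_eventuallyEq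
    (f₁ := 𝒢.mul ∘ fun y ↦ (𝒢.one y, 𝒢.one y)) (Filter.Eventually.of_forall 𝒢.mul_one_one)
  exact TangentBundle.mk_eq_mk (𝒢.mul_one_one x) (DFunLike.congr_fun (hasMFDerivAt_unique h1 h2) v)

end LieGroupoid

/-! ### Multiplicative and affine forms -/

/-- Evaluating a form depends only on the arguments as points of the tangent bundle. This compares
values at base points that are equal only propositionally; the hypothesis `x = y` is needed
separately for `k = 0`. -/
theorem DiffForm.apply_eq_of_tangentBundle_eq {E : Type*} [NormedAddCommGroup E] [NormedSpace ℝ E]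
    {X : Type*} [TopologicalSpace X] [ChartedSpace E X] [IsManifold 𝓘(ℝ, E) ∞ X] {k : ℕ}
    (θ : DiffForm E X k) {x y : X} (h : x = y) {v : Fin k → TangentSpace 𝓘(ℝ, E) x}
    {w : Fin k → TangentSpace 𝓘(ℝ, E) y}
    (hvw : ∀ i, (⟨x, v i⟩ : TangentBundle 𝓘(ℝ, E) X) = ⟨y, w i⟩) :
    (θ x v : ℝ) = (θ y w : ℝ) := by
  subst h
  have : v = w := funext fun i ↦ TangentBundle.snd_eq_snd (hvw i)
  rw [this]

theorem DiffForm.ext_apply {E : Type*} [NormedAddCommGroup E] [NormedSpace ℝ E]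
    {X : Type*} [TopologicalSpace X] [ChartedSpace E X] [IsManifold 𝓘(ℝ, E) ∞ X] {k : ℕ}
    {θ θ' : DiffForm E X k}
    (h : ∀ (x : X) (v : Fin k → TangentSpace 𝓘(ℝ, E) x), (θ x v : ℝ) = (θ' x v : ℝ)) :
    θ = θ' :=
  ContMDiffSection.ext fun x ↦ ContinuousAlternatingMap.ext fun v ↦ h x v

namespace LieGroupoid

variable {EG : Type*} [NormedAddCommGroup EG] [NormedSpace ℝ EG]
  {G : Type*} [TopologicalSpace G] [ChartedSpace EG G] [IsManifold 𝓘(ℝ, EG) ∞ G]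
  {EM : Type*} [NormedAddCommGroup EM] [NormedSpace ℝ EM]
  {M : Type*} [TopologicalSpace M] [ChartedSpace EM M] [IsManifold 𝓘(ℝ, EM) ∞ M]
  (𝒢 : LieGroupoid EG G EM M) {k : ℕ}

theorem unitPullback_srcPullback (θ : DiffForm EM M k) :
    𝒢.unitPullback (𝒢.srcPullback θ) = θ :=
  DiffForm.ext_apply fun x v ↦
    θ.apply_eq_of_tangentBundle_eq (𝒢.src_one x) fun i ↦ 𝒢.tangentMap_src_tangentMap_one ⟨x, v i⟩

theorem unitPullback_tgtPullback (θ : DiffForm EM M k) :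
    𝒢.unitPullback (𝒢.tgtPullback θ) = θ :=
  DiffForm.ext_apply fun x v ↦
    θ.apply_eq_of_tangentBundle_eq (𝒢.tgt_one x) fun i ↦ 𝒢.tangentMap_tgt_tangentMap_one ⟨x, v i⟩

theorem srcPullback_tangentMul (θ : DiffForm EM M k) {g h : G}
    (hgh : (g, h) ∈ 𝒢.composable) {X : Fin k → TangentSpace 𝓘(ℝ, EG) g}
    {Y : Fin k → TangentSpace 𝓘(ℝ, EG) h} (hXY : ∀ i, 𝒢.TangentComposable (X i) (Y i)) :
    (𝒢.srcPullback θ (𝒢.mul (g, h)) (fun i ↦ 𝒢.tangentMul (X i) (Y i)) : ℝ) =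
      (𝒢.srcPullback θ h Y : ℝ) :=
  θ.apply_eq_of_tangentBundle_eq (𝒢.src_mul g h hgh) fun i ↦ 𝒢.tangentMap_src_tangentMul hgh (hXY i)

theorem tgtPullback_tangentMul (θ : DiffForm EM M k) {g h : G}
    (hgh : (g, h) ∈ 𝒢.composable) {X : Fin k → TangentSpace 𝓘(ℝ, EG) g}
    {Y : Fin k → TangentSpace 𝓘(ℝ, EG) h} (hXY : ∀ i, 𝒢.TangentComposable (X i) (Y i)) :
    (𝒢.tgtPullback θ (𝒢.mul (g, h)) (fun i ↦ 𝒢.tangentMul (X i) (Y i)) : ℝ) =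
      (𝒢.tgtPullback θ g X : ℝ) :=
  θ.apply_eq_of_tangentBundle_eq (𝒢.tgt_mul g h hgh) fun i ↦ 𝒢.tangentMap_tgt_tangentMul hgh (hXY i)

theorem srcPullback_eq_tgtPullback (θ : DiffForm EM M k) {g h : G}
    (hgh : (g, h) ∈ 𝒢.composable) {X : Fin k → TangentSpace 𝓘(ℝ, EG) g}
    {Y : Fin k → TangentSpace 𝓘(ℝ, EG) h} (hXY : ∀ i, 𝒢.TangentComposable (X i) (Y i)) :
    (𝒢.srcPullback θ g X : ℝ) = (𝒢.tgtPullback θ h Y : ℝ) :=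
  θ.apply_eq_of_tangentBundle_eq hgh hXY

theorem isAffine_srcPullback (θ : DiffForm EM M k) : 𝒢.IsAffine (𝒢.srcPullback θ) := by
  intro g h hgh X Y hXY
  rw [𝒢.srcPullback_tangentMul θ hgh hXY, unitPullback_srcPullback]
  ring

theorem isAffine_tgtPullback (θ : DiffForm EM M k) : 𝒢.IsAffine (𝒢.tgtPullback θ) := by
  intro g h hgh X Y hXY
  rw [𝒢.tgtPullback_tangentMul θ hgh hXY, unitPullback_tgtPullback,
    𝒢.srcPullback_eq_tgtPullback θ hgh hXY]
  ring

variable {𝒢} {Θ : DiffForm EG G k}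

/-- Restricting `m^*Θ = pr₁^*Θ + pr₂^*Θ` to pairs of units gives `ι^*Θ = ι^*Θ + ι^*Θ`. -/
theorem IsMultiplicative.unitPullback_eq_zero (hΘ : 𝒢.IsMultiplicative Θ) :
    𝒢.unitPullback Θ = 0 := by
  refine DiffForm.ext_apply fun x v ↦ ?_
  have h1 := hΘ (𝒢.one x) (𝒢.one x) (𝒢.one_one_mem_composable x)
    (fun i ↦ mfderiv 𝓘(ℝ, EM) 𝓘(ℝ, EG) 𝒢.one x (v i))
    (fun i ↦ mfderiv 𝓘(ℝ, EM) 𝓘(ℝ, EG) 𝒢.one x (v i))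
    (fun i ↦ (𝒢.tangentMap_src_tangentMap_one ⟨x, v i⟩).trans
      (𝒢.tangentMap_tgt_tangentMap_one ⟨x, v i⟩).symm)
  have h2 := Θ.apply_eq_of_tangentBundle_eq (𝒢.mul_one_one x)
    fun i ↦ 𝒢.tangentMul_mfderiv_one x (v i)
  exact left_eq_add.1 (h2.symm.trans h1)

theorem isAffine_iff_isMultiplicative (h0 : 𝒢.unitPullback Θ = 0) :
    𝒢.IsAffine Θ ↔ 𝒢.IsMultiplicative Θ := by
  have h : ∀ (g : G) (X : Fin k → TangentSpace 𝓘(ℝ, EG) g),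
      (𝒢.srcPullback (𝒢.unitPullback Θ) g X : ℝ) = 0 := fun g X ↦ by
    rw [h0, map_zero]; rfl
  simp only [IsAffine, IsMultiplicative, h, sub_zero]

theorem IsMultiplicative.isAffine (hΘ : 𝒢.IsMultiplicative Θ) : 𝒢.IsAffine Θ :=
  (isAffine_iff_isMultiplicative hΘ.unitPullback_eq_zero).2 hΘ

theorem IsAffine.isMultiplicative_sub_srcPullback (hΘ : 𝒢.IsAffine Θ) :
    𝒢.IsMultiplicative (Θ - 𝒢.srcPullback (𝒢.unitPullback Θ)) :=
  (isAffine_iff_isMultiplicative (by rw [map_sub, unitPullback_srcPullback, sub_self])).1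
    ((𝒢.affForms k).sub_mem hΘ (𝒢.isAffine_srcPullback _))

theorem IsAffine.isMultiplicative_sub_tgtPullback (hΘ : 𝒢.IsAffine Θ) :
    𝒢.IsMultiplicative (Θ - 𝒢.tgtPullback (𝒢.unitPullback Θ)) :=
  (isAffine_iff_isMultiplicative (by rw [map_sub, unitPullback_tgtPullback, sub_self])).1
    ((𝒢.affForms k).sub_mem hΘ (𝒢.isAffine_tgtPullback _))

end LieGroupoid

/-! ### The 2-vector space of affine forms -/

noncomputable section

namespace LieGroupoid

variable {EG : Type*} [NormedAddCommGroup EG] [NormedSpace ℝ EG]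
  {G : Type*} [TopologicalSpace G] [ChartedSpace EG G] [IsManifold 𝓘(ℝ, EG) ∞ G]
  {EM : Type*} [NormedAddCommGroup EM] [NormedSpace ℝ EM]
  {M : Type*} [TopologicalSpace M] [ChartedSpace EM M] [IsManifold 𝓘(ℝ, EM) ∞ M]
  (𝒢 : LieGroupoid EG G EM M) (k : ℕ)

/-- The source map `Θ ↦ Θ_r = Θ - t^*ι^*Θ`, as a linear map. -/
def rightForm : 𝒢.affForms k →ₗ[ℝ] 𝒢.multForms k :=
  ((LinearMap.id - 𝒢.tgtPullback ∘ₗ 𝒢.unitPullback).domRestrict (𝒢.affForms k)).codRestrict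
    (𝒢.multForms k) fun Θ ↦ IsAffine.isMultiplicative_sub_tgtPullback Θ.2

/-- The target map `Θ ↦ Θ_l = Θ - s^*ι^*Θ`, as a linear map. -/
def leftForm : 𝒢.affForms k →ₗ[ℝ] 𝒢.multForms k :=
  ((LinearMap.id - 𝒢.srcPullback ∘ₗ 𝒢.unitPullback).domRestrict (𝒢.affForms k)).codRestrict
    (𝒢.multForms k) fun Θ ↦ IsAffine.isMultiplicative_sub_srcPullback Θ.2

theorem multForms_le_affForms : 𝒢.multForms k ≤ 𝒢.affForms k :=
  fun _ hΘ ↦ IsMultiplicative.isAffine hΘ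

/-- The pullback `s^*`, with values in the affine forms. -/
def affSrcPullback : DiffForm EM M k →ₗ[ℝ] 𝒢.affForms k :=
  𝒢.srcPullback.codRestrict (𝒢.affForms k) 𝒢.isAffine_srcPullback

/-- The restriction `ι^*` to the units, on affine forms. -/
def affUnitPullback : 𝒢.affForms k →ₗ[ℝ] DiffForm EM M k :=
  𝒢.unitPullback.domRestrict (𝒢.affForms k)

/-- The composition `Θ * Θ' = Θ + s^*ι^*Θ'`. The formula makes sense, and is affine, for all pairs
of affine forms, not only for those with `Θ_r = Θ'_l`. -/
def affComp : 𝒢.affForms k × 𝒢.affForms k →ₗ[ℝ] 𝒢.affForms k :=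
  LinearMap.coprod LinearMap.id (𝒢.affSrcPullback k ∘ₗ 𝒢.affUnitPullback k)

variable {k}

theorem coe_rightForm (Θ : 𝒢.affForms k) :
    (𝒢.rightForm k Θ : DiffForm EG G k) =
      Θ - 𝒢.tgtPullback (𝒢.unitPullback (Θ : DiffForm EG G k)) := rfl

theorem coe_leftForm (Θ : 𝒢.affForms k) :
    (𝒢.leftForm k Θ : DiffForm EG G k) =
      Θ - 𝒢.srcPullback (𝒢.unitPullback (Θ : DiffForm EG G k)) := rfl

theorem coe_affComp (p : 𝒢.affForms k × 𝒢.affForms k) :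
    (𝒢.affComp k p : DiffForm EG G k) =
      p.1 + 𝒢.srcPullback (𝒢.unitPullback (p.2 : DiffForm EG G k)) := rfl

variable (k) in
/-- The 2-vector space of affine `k`-forms (arrows) over multiplicative `k`-forms (objects). -/
def affTwoVectorSpace : TwoVectorSpace ℝ (𝒢.affForms k) (𝒢.multForms k) where
  src := 𝒢.rightForm k
  tgt := 𝒢.leftForm k
  ident := Submodule.inclusion (𝒢.multForms_le_affForms k)
  comp := (𝒢.affComp k).domRestrict _
  src_ident Λ := Subtype.ext <| by
    rw [coe_rightForm, Submodule.coe_inclusion, Λ.2.unitPullback_eq_zero, map_zero, sub_zero]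
  tgt_ident Λ := Subtype.ext <| by
    rw [coe_leftForm, Submodule.coe_inclusion, Λ.2.unitPullback_eq_zero, map_zero, sub_zero]
  src_comp Θ Θ' h := Subtype.ext <| by
    have h' := congrArg (Subtype.val : 𝒢.multForms k → DiffForm EG G k) h
    simp only [coe_rightForm, coe_leftForm] at h'
    simp only [LinearMap.domRestrict_apply, coe_rightForm, coe_affComp, map_add,
      unitPullback_srcPullback]
    rw [← sub_eq_zero] at h' ⊢
    refine Eq.trans ?_ h'
    abel
  tgt_comp Θ Θ' _ := Subtype.ext <| by
    simp only [LinearMap.domRestrict_apply, coe_leftForm, coe_affComp, map_add,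
      unitPullback_srcPullback]
    abel
  ident_comp Θ := Subtype.ext <| by
    simp only [LinearMap.domRestrict_apply, coe_affComp, Submodule.coe_inclusion, coe_leftForm,
      sub_add_cancel]
  comp_ident Θ := Subtype.ext <| by
    simp only [LinearMap.domRestrict_apply, coe_affComp, Submodule.coe_inclusion,
      (𝒢.rightForm k Θ).2.unitPullback_eq_zero, map_zero, add_zero]
  assoc Θ Θ' Θ'' _ _ := Subtype.ext <| by
    simp only [LinearMap.domRestrict_apply, coe_affComp]
    rw [map_add, unitPullback_srcPullback, map_add, add_assoc]

theorem isGroupoid_affTwoVectorSpace : (𝒢.affTwoVectorSpace k).IsGroupoid := by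
  intro Θ
  let θ := 𝒢.unitPullback (Θ : DiffForm EG G k)
  -- The inverse of `Θ` is `Θ - s^*θ - t^*θ`, which restricts to `-θ` on the units.
  let Ψ : 𝒢.affForms k := ⟨Θ - 𝒢.srcPullback θ - 𝒢.tgtPullback θ,
    (𝒢.affForms k).sub_mem ((𝒢.affForms k).sub_mem Θ.2 (𝒢.isAffine_srcPullback θ))
      (𝒢.isAffine_tgtPullback θ)⟩
  have hΨ : 𝒢.unitPullback (Ψ : DiffForm EG G k) = -θ := by
    simp only [Ψ, map_sub, unitPullback_srcPullback, unitPullback_tgtPullback]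
    abel
  refine ⟨Ψ, Subtype.ext ?_, Subtype.ext ?_, Subtype.ext ?_, Subtype.ext ?_⟩
  · change (Θ : DiffForm EG G k) - 𝒢.tgtPullback θ =
      Ψ - 𝒢.srcPullback (𝒢.unitPullback (Ψ : DiffForm EG G k))
    rw [hΨ, map_neg]
    simp only [Ψ]
    abel
  · change (Ψ : DiffForm EG G k) - 𝒢.tgtPullback (𝒢.unitPullback (Ψ : DiffForm EG G k)) =
      Θ - 𝒢.srcPullback θ
    rw [hΨ, map_neg]
    simp only [Ψ]
    abel
  · change (Θ : DiffForm EG G k) + 𝒢.srcPullback (𝒢.unitPullback (Ψ : DiffForm EG G k)) =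
      Θ - 𝒢.srcPullback θ
    rw [hΨ, map_neg, sub_eq_add_neg]
  · change (Ψ : DiffForm EG G k) + 𝒢.srcPullback θ = Θ - 𝒢.tgtPullback θ
    simp only [Ψ]
    abel

end LieGroupoid
end

theorem mainTheorem4
    {EG : Type*} [NormedAddCommGroup EG] [NormedSpace ℝ EG] [FiniteDimensional ℝ EG]
    {G : Type*} [TopologicalSpace G] [ChartedSpace EG G] [IsManifold 𝓘(ℝ, EG) ∞ G]
    {EM : Type*} [NormedAddCommGroup EM] [NormedSpace ℝ EM] [FiniteDimensional ℝ EM]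
    {M : Type*} [TopologicalSpace M] [ChartedSpace EM M] [IsManifold 𝓘(ℝ, EM) ∞ M]
    (𝒢 : LieGroupoid EG G EM M) (k : ℕ) :
    ∃ C : TwoVectorSpace ℝ (𝒢.affForms k) (𝒢.multForms k),
      (∀ Θ : 𝒢.affForms k,
        (C.src Θ : DiffForm EG G k) = Θ - 𝒢.tgtPullback (𝒢.unitPullback (Θ : DiffForm EG G k))) ∧
      (∀ Θ : 𝒢.affForms k,
        (C.tgt Θ : DiffForm EG G k) = Θ - 𝒢.srcPullback (𝒢.unitPullback (Θ : DiffForm EG G k))) ∧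
      (∀ Λ : 𝒢.multForms k, (C.ident Λ : DiffForm EG G k) = Λ) ∧
      (∀ (Θ Θ' : 𝒢.affForms k) (h : C.src Θ = C.tgt Θ'),
        (C.comp ⟨(Θ, Θ'), h⟩ : DiffForm EG G k) =
          Θ + 𝒢.srcPullback (𝒢.unitPullback (Θ' : DiffForm EG G k))) ∧
      C.IsGroupoid :=
  ⟨𝒢.affTwoVectorSpace k, fun _ ↦ rfl, fun _ ↦ rfl, fun _ ↦ rfl, fun _ _ _ ↦ rfl,
    𝒢.isGroupoid_affTwoVectorSpace⟩
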